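/- Let $\mathcal X,\mathcal Y$ be measurable spaces and let $P$ (source) and $Q$ (target) be probability distributions on $\mathcal X\times\mathcal Y$ satisfying covariate shift: they have a common conditional distribution of $y$ given $x$. Let $p,q\ge 0$ be the (finite) densities of the marginals $P_X,Q_X$ with respect to a common measure on $\mathcal X$, with $q(x)=0$ wherever $p(x)=0$; let $w^*(x)=q(x)/p(x)$ (with $w^*(x)=0$ if $p(x)=q(x)=0$), and let $b\in\mathbb R$ satisfy $w^*(x)\le b$ for all $x$. Let $f:\mathcal X\times\mathcal Y\to\mathbb R_{\ge0}$ be measurable, $C_\tau(x)=\{y: f(x,y)\ge\tau\}$ for $\tau\ge0$, and $L_Q(C)=\Pr_{(x,y)\sim Q}[y\notin C(x)]$. Let $\varepsilon,\delta_C,\delta_w\in(0,1)$ and $m,n\ge 0$. Let $S_m=((x_i,y_i))_{i\le m}\sim P^m$, $V=(V_i)_{i\le m}\sim\mathrm{Uniform}([0,1])^m$ and $T_n^X\sim Q_X^n$ be independent, and let $S_m^X=(x_i)_{i\le m}$. For $k,N\in\mathbb N$ put $F(k;N,\theta)=\sum_{i=0}^{k}\binom{N}{i}\theta^i(1-\theta)^{N-i}$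 and $$\overline\theta(k;N,\delta)=\inf\big(\{\theta\in[0,1]: F(k;N,\theta)\le\delta\}\cup\{1\}\big).$$ For $w\in\mathbb R^m$ put $U_{\mathrm{RSCP}}(C,S_m,V,w,b,\delta)=\overline\theta(k;N,\delta)$, where $N=\#\{i: V_i\le w_i/b\}$ and $k=\#\{i: V_i\le w_i/b,\ y_i\notin C(x_i)\}$. Let $\underline w,\overline w\in\mathbb R^m$ be measurable functions of $(S_m^X,T_n^X)$ such that the box $\mathcal W=\{w\in\mathbb R^m:\underline w_i\le w_i\le\overline w_i\ \forall i\}$ satisfies $$\Pr_{S_m^X\sim P_X^m,\,T_n^X\sim Q_X^n}\big[(w^*(x_1),\dots,w^*(x_m))\in\mathcal W\big]\ge 1-\delta_w .$$ For $\tau\ge0$ let $\hat w_\tau\in\mathbb R^m$ have $i$-th coordinate $\overline w_i$ if $y_i\notin C_\tau(x_i)$ and $\underline w_i$ if $y_i\in C_\tau(x_i)$, and let $$\hat\tau=\max\{\tau\ge0:\ U_{\mathrm{RSCP}}(C_\tau,S_m,V,\hat w_\tau,b,\delta_C)\le\varepsilon\},$$ with $\hat\tau=0$ if no such $\tau$ exists.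 Then this maximum is attained whenever the set is nonempty, and $$\Pr_{S_m\sim P^m,\,V\sim \mathrm{Uniform}([0,1])^m,\,T_n^X\sim Q_X^n}\big[L_Q(C_\tau)\le\varepsilon\ \text{ for all } 0\le\tau\le\hat\tau\big]\ \ge\ 1-\delta_C-\delta_w .$$ -/

import Mathlib

open MeasureTheory ProbabilityTheory
open scoped NNReal ENNReal

noncomputable section

namespace CovShift

variable {X Y : Type*}

/-- The prediction set `C_τ(x) = {y | f(x, y) ≥ τ}`. -/
def predSet (f : X × Y → ℝ≥0) (τ : ℝ≥0) (x : X) : Set Y := {y | τ ≤ f (x, y)}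

/-- The expected error `L_Q(C) = ℙ_{(x, y) ∼ Q}[y ∉ C(x)]`. -/
def expectedError [MeasurableSpace X] [MeasurableSpace Y] (Q : Measure (X × Y))
    (C : X → Set Y) : ℝ :=
  Q.real {z | z.2 ∉ C z.1}

/-- The binomial CDF `F(k; m, θ)`. -/
def binomCDF (k m : ℕ) (θ : ℝ) : ℝ :=
  ∑ i ∈ Finset.range (k + 1), (m.choose i : ℝ) * θ ^ i * (1 - θ) ^ (m - i)

/-- The Clopper-Pearson upper bound `inf ({θ ∈ [0, 1] | F(k; m, θ) ≤ δ} ∪ {1})`. -/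
def cpUpper (k m : ℕ) (δ : ℝ) : ℝ :=
  sInf ({θ : ℝ | θ ∈ Set.Icc 0 1 ∧ binomCDF k m θ ≤ δ} ∪ {1})

open Classical in
/-- The number of errors of `C` on a finite sample (repeated examples count repeatedly). -/
def errorCount (C : X → Set Y) (T : Multiset (X × Y)) : ℕ :=
  T.countP (fun z => z.2 ∉ C z.1)

/-- The bound `U_CP(C, T, δ)`. -/
def uCP (C : X → Set Y) (T : Multiset (X × Y)) (δ : ℝ) : ℝ :=
  cpUpper (errorCount C T) T.card δ

open Classical in
/-- The examples `(x_i, y_i)` accepted by rejection sampling, i.e. those with `V_i ≤ w_i / b`. -/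
def acceptedSample {m : ℕ} (S : Fin m → X × Y) (V w : Fin m → ℝ) (b : ℝ) : Multiset (X × Y) :=
  (Finset.univ.filter (fun i => V i ≤ w i / b)).val.map S

/-- The rejection-sampling Clopper-Pearson bound `U_RSCP(C, S, V, w, b, δ)`. -/
def uRSCP {m : ℕ} (C : X → Set Y) (S : Fin m → X × Y) (V w : Fin m → ℝ) (b δ : ℝ) : ℝ :=
  uCP C (acceptedSample S V w b) δ

/-- The uncertainty box `{w | ∀ i, lo_i ≤ w_i ≤ hi_i}`. -/
def uncertaintyBox {m : ℕ} (lo hi : Fin m → ℝ) : Set (Fin m → ℝ) :=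
  {w | ∀ i, lo i ≤ w i ∧ w i ≤ hi i}

open Classical in
/-- The greedy weights: the upper weight on errors of `C`, the lower weight on non-errors. -/
def greedyWeights {m : ℕ} (C : X → Set Y) (S : Fin m → X × Y) (lo hi : Fin m → ℝ) :
    Fin m → ℝ :=
  fun i => if (S i).2 ∉ C (S i).1 then hi i else lo i

/-- The thresholds `τ ≥ 0` at which the RSCP bound, evaluated at the greedy weights, is `≤ ε`. -/
def feasible {m : ℕ} (f : X × Y → ℝ≥0) (S : Fin m → X × Y) (V lo hi : Fin m → ℝ)
    (b δ ε : ℝ) : Set ℝ≥0 :=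
  {τ | uRSCP (predSet f τ) S V (greedyWeights (predSet f τ) S lo hi) b δ ≤ ε}

/-- The selected threshold: the largest feasible one, and `0` if there is none. (The supremum of
`∅` in `ℝ≥0` is `0`.) -/
def tauHat {m : ℕ} (f : X × Y → ℝ≥0) (S : Fin m → X × Y) (V lo hi : Fin m → ℝ)
    (b δ ε : ℝ) : ℝ≥0 :=
  sSup (feasible f S V lo hi b δ ε)

/-- The importance weight `w*(x) = q(x) / p(x)`. -/
def importanceWeight (p q : X → ℝ≥0) (x : X) : ℝ := (q x : ℝ) / (p x : ℝ)

/-- The uniform distribution on `[0, 1]`. -/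
def uniform01 : Measure ℝ := volume.restrict (Set.Icc 0 1)

/-- The joint law of the labeled source sample `S ∼ P^m`, the uniforms `V ∼ U^m` and the
unlabeled target sample `T ∼ Q_X^n`, all independent. -/
def dataLaw [MeasurableSpace X] [MeasurableSpace Y] (P Q : Measure (X × Y)) (m n : ℕ) :
    Measure ((Fin m → X × Y) × (Fin m → ℝ) × (Fin n → X)) :=
  (Measure.pi fun _ : Fin m => P).prod
    ((Measure.pi fun _ : Fin m => uniform01).prod (Measure.pi fun _ : Fin n => Q.fst))

end CovShift

end

namespace CovShift

/-! ### Monotonicity of the binomial distribution function -/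

/-! One critical error set replaces a union bound over thresholds. The sublevel sets `{f < τ}` are
nested, and those of `Q`-mass above `ε` share a measurable subset `E` of mass at least `ε`
(`exists_measurableSet_subset_sublevel`). `E` depends on `Q` and `f`, not on the data.

If some `τ ≤ τ̂` has error above `ε`, then `E ⊆ {f < τ} ⊆ {f < τ̂}`. When the true weights lie in
the box, passing from the greedy weights at `τ̂` to the true weights, and from `{f < τ̂}` to `E`,
can only remove errors and add non-errors. Both changes lower the binomial distribution function, so
feasibility of `τ̂` makes the Clopper-Pearson test for `E` reject at level `δC` and parameter `Q(E)`
(`binomCDF_le_of_mem_feasible`).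

At the true weights, rejection sampling turns source examples into target examples, so this
rejection has probability at most `δC` (`measureReal_binomCDF_accepted_le`). The box fails with
probability at most `δw`. -/

theorem binomCDF_zero_left (N : ℕ) (θ : ℝ) : binomCDF 0 N θ = (1 - θ) ^ N := by
  simp [binomCDF]

theorem binomCDF_zero_right (k : ℕ) (θ : ℝ) : binomCDF k 0 θ = 1 := by
  rw [binomCDF, Finset.sum_eq_single_of_mem 0 (by simp)]
  · simp
  · intro i _ hi
    simp [Nat.choose_eq_zero_of_lt (Nat.pos_of_ne_zero hi)]

/-- Conditioning on one trial (Pascal's rule); the monotonicity facts below rest on this recursion.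
-/
theorem binomCDF_succ_succ (k N : ℕ) (θ : ℝ) :
    binomCDF (k + 1) (N + 1) θ = θ * binomCDF k N θ + (1 - θ) * binomCDF (k + 1) N θ := by
  have key : ∀ i, ((N + 1).choose (i + 1) : ℝ) * θ ^ (i + 1) * (1 - θ) ^ (N + 1 - (i + 1)) =
      θ * ((N.choose i : ℝ) * θ ^ i * (1 - θ) ^ (N - i)) +
        (1 - θ) * ((N.choose (i + 1) : ℝ) * θ ^ (i + 1) * (1 - θ) ^ (N - (i + 1))) := by
    intro i
    rw [Nat.choose_succ_succ, Nat.add_sub_add_right]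
    rcases Nat.lt_or_ge i N with h | h
    · obtain ⟨d, rfl⟩ := Nat.exists_eq_add_of_lt h
      rw [show i + d + 1 - i = d + 1 by omega, show i + d + 1 - (i + 1) = d by omega]
      push_cast
      ring
    · rw [Nat.choose_eq_zero_of_lt (Nat.lt_succ_of_le h)]
      push_cast
      ring
  simp only [binomCDF]
  rw [Finset.sum_range_succ', Finset.sum_range_succ' _ (k + 1), mul_add, Finset.mul_sum,
    Finset.mul_sum, ← add_assoc, ← Finset.sum_add_distrib]
  congr 1
  · exact Finset.sum_congr rfl fun i _ => key i
  · simp [pow_succ']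

theorem binomCDF_le_succ_left (k N : ℕ) {θ : ℝ} (hθ : θ ∈ Set.Icc (0 : ℝ) 1) :
    binomCDF k N θ ≤ binomCDF (k + 1) N θ := by
  have h1 : 0 ≤ 1 - θ := sub_nonneg.2 hθ.2
  have h0 := hθ.1
  rw [binomCDF, binomCDF, Finset.sum_range_succ _ (k + 1)]
  exact le_add_of_nonneg_right (by positivity)

theorem binomCDF_le_succ_succ (k N : ℕ) {θ : ℝ} (hθ : θ ∈ Set.Icc (0 : ℝ) 1) :
    binomCDF k N θ ≤ binomCDF (k + 1) (N + 1) θ := by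
  rw [binomCDF_succ_succ]
  nlinarith [binomCDF_le_succ_left k N hθ, hθ.2]

theorem binomCDF_succ_right_le (k N : ℕ) {θ : ℝ} (hθ : θ ∈ Set.Icc (0 : ℝ) 1) :
    binomCDF k (N + 1) θ ≤ binomCDF k N θ := by
  cases k with
  | zero =>
    rw [binomCDF_zero_left, binomCDF_zero_left]
    exact pow_le_pow_of_le_one (sub_nonneg.2 hθ.2) (by linarith [hθ.1]) (Nat.le_succ N)
  | succ k =>
    rw [binomCDF_succ_succ]
    nlinarith [binomCDF_le_succ_left k N hθ, hθ.1]

/-- More failures and fewer successes increase the binomial distribution function. -/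
theorem binomCDF_add_le {k k' s s' : ℕ} (hk : k ≤ k') (hs : s' ≤ s) {θ : ℝ}
    (hθ : θ ∈ Set.Icc (0 : ℝ) 1) :
    binomCDF k (k + s) θ ≤ binomCDF k' (k' + s') θ := by
  have hmono : Monotone fun k => binomCDF k (k + s) θ := monotone_nat_of_le_succ fun k => by
    rw [Nat.succ_add_eq_add_succ k s]
    exact binomCDF_le_succ_succ k (k + s) hθ
  have hanti : Antitone fun N => binomCDF k' N θ :=
    antitone_nat_of_succ_le fun N => binomCDF_succ_right_le k' N hθ
  exact (hmono hk).trans (hanti (Nat.add_le_add_left hs k'))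

/-- In the recursion, raising `θ` shifts weight to the smaller term `binomCDF k N`; induction on `N`
handles the rest. -/
theorem binomCDF_antitoneOn (k N : ℕ) : AntitoneOn (binomCDF k N) (Set.Icc 0 1) := by
  intro θ hθ θ' hθ' h
  induction N generalizing k with
  | zero => simp [binomCDF_zero_right]
  | succ N ih =>
    cases k with
    | zero =>
      rw [binomCDF_zero_left, binomCDF_zero_left]
      exact pow_le_pow_left₀ (sub_nonneg.2 hθ'.2) (by linarith) _
    | succ k =>
      rw [binomCDF_succ_succ, binomCDF_succ_succ]
      have h1 := mul_le_mul_of_nonneg_left (ih k) hθ.1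
      have h2 := mul_le_mul_of_nonneg_left (ih (k + 1)) (sub_nonneg.2 hθ.2)
      nlinarith [mul_le_mul_of_nonneg_right h (sub_nonneg.2 (binomCDF_le_succ_left k N hθ'))]

theorem continuous_binomCDF (k N : ℕ) : Continuous (binomCDF k N) := by
  unfold binomCDF
  fun_prop

theorem binomCDF_self (N : ℕ) (θ : ℝ) : binomCDF N N θ = 1 := by
  have h := add_pow θ (1 - θ) N
  rw [add_sub_cancel, one_pow] at h
  refine Eq.trans ?_ h.symm
  exact Finset.sum_congr rfl fun i _ => by ring

/-! ### The Clopper-Pearson bound -/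

theorem cpUpper_self (N : ℕ) {δ : ℝ} (hδ : δ < 1) : cpUpper N N δ = 1 := by
  have : {θ : ℝ | θ ∈ Set.Icc 0 1 ∧ binomCDF N N θ ≤ δ} = ∅ := by
    ext θ
    simp [binomCDF_self, hδ]
  rw [cpUpper, this, Set.empty_union, csInf_singleton]

/-- The infimum is attained because the set is closed, and `ε < 1` excludes the adjoined point `1`;
antitonicity in `θ` then carries the inequality upward. -/
theorem binomCDF_le_of_cpUpper_le {k N : ℕ} {δ ε θ : ℝ} (h : cpUpper k N δ ≤ ε) (hε : ε < 1)
    (hεθ : ε ≤ θ) (hθ : θ ≤ 1) : binomCDF k N θ ≤ δ := by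
  have hclosed : IsClosed ({θ : ℝ | θ ∈ Set.Icc 0 1 ∧ binomCDF k N θ ≤ δ} ∪ {1}) :=
    (isClosed_Icc.inter (isClosed_le (continuous_binomCDF k N) continuous_const)).union
      isClosed_singleton
  have hbdd : BddBelow ({θ : ℝ | θ ∈ Set.Icc 0 1 ∧ binomCDF k N θ ≤ δ} ∪ {1}) :=
    ⟨0, by rintro x (hx | rfl); exacts [hx.1.1, zero_le_one]⟩
  have hmem := hclosed.csInf_mem ⟨1, Or.inr rfl⟩ hbdd
  change cpUpper k N δ ∈ _ at hmem
  rcases hmem with ⟨hI, hle⟩ | h1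
  · exact (binomCDF_antitoneOn k N hI ⟨hI.1.trans (h.trans hεθ), hθ⟩ (h.trans hεθ)).trans hle
  · rw [Set.mem_singleton_iff] at h1
    linarith

/-- The distribution function of a binomial variable, evaluated at that variable, is
stochastically at least uniform. -/
theorem sum_powerset_binomCDF_le {ι : Type*} (I : Finset ι) {θ δ : ℝ}
    (hθ : θ ∈ Set.Icc (0 : ℝ) 1) (hδ : 0 ≤ δ) :
    ∑ J ∈ I.powerset with binomCDF J.card I.card θ ≤ δ,
      θ ^ J.card * (1 - θ) ^ (I.card - J.card) ≤ δ := by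
  have h1 : 0 ≤ 1 - θ := sub_nonneg.2 hθ.2
  have h0 := hθ.1
  set N := I.card
  rw [Finset.sum_filter, Finset.sum_powerset_apply_card
    (fun j => if binomCDF j N θ ≤ δ then θ ^ j * (1 - θ) ^ (N - j) else 0)]
  simp only [smul_ite, smul_zero]
  rw [← Finset.sum_filter]
  rcases (Finset.filter (fun j => binomCDF j N θ ≤ δ) (Finset.range (N + 1))).eq_empty_or_nonempty
    with he | hne
  · rw [he, Finset.sum_empty]
    exact hδ
  -- For the largest count `j` with `F(j) ≤ δ`, the whole sum is at most `F(j)`.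
  · have hmax := Finset.max'_mem _ hne
    refine le_trans ?_ (Finset.mem_filter.1 hmax).2
    rw [binomCDF]
    simp only [nsmul_eq_mul, ← mul_assoc]
    refine Finset.sum_le_sum_of_subset_of_nonneg (fun j hj => ?_) fun _ _ _ => by positivity
    exact Finset.mem_range_succ_iff.2 (Finset.le_max' _ j hj)

open Classical in
/-- Validity of the Clopper-Pearson test conditionally on the accepted part of an i.i.d. sample:
`A` is the acceptance region, and an accepted point lies in `E` with probability `θ`. -/
theorem measureReal_pi_binomCDF_le {ι Ω : Type*} [Fintype ι] [MeasurableSpace Ω] (ν : Measure Ω)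
    [IsProbabilityMeasure ν] {A E : Set Ω} (hA : MeasurableSet A) (hE : MeasurableSet E) {θ δ : ℝ}
    (hθ : θ ∈ Set.Icc (0 : ℝ) 1) (hδ : 0 ≤ δ) (h : ν.real (A ∩ E) = ν.real A * θ) :
    (Measure.pi fun _ : ι => ν).real {ω | binomCDF (Finset.card {i | ω i ∈ A ∧ ω i ∈ E})
      (Finset.card {i | ω i ∈ A}) θ ≤ δ} ≤ δ := by
  set a := ν.real A with ha
  have ha0 : 0 ≤ a := measureReal_nonneg
  have ha1 : 0 ≤ 1 - a := sub_nonneg.2 measureReal_le_one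
  have hdiff : ν.real (A \ E) = a * (1 - θ) := by
    have := measureReal_inter_add_sdiff (μ := ν) (s := A) hE
    rw [h] at this
    linarith
  have hcompl : ν.real Aᶜ = 1 - a := probReal_compl_eq_one_sub hA
  -- `I` is the set of accepted indices and `J ⊆ I` the set of accepted indices in `E`; each such
  -- cell is a product set.
  let cell (I J : Finset ι) : Set (ι → Ω) :=
    Set.univ.pi fun i => if i ∈ I then if i ∈ J then A ∩ E else A \ E else Aᶜ
  have hcell : ∀ I J : Finset ι, J ⊆ I → (Measure.pi fun _ : ι => ν).real (cell I J) =
      (a ^ I.card * (1 - a) ^ (Fintype.card ι - I.card)) *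
        (θ ^ J.card * (1 - θ) ^ (I.card - J.card)) := by
    intro I J hJI
    have hpi : (Measure.pi fun _ : ι => ν).real (cell I J) =
        ∏ i, if i ∈ I then if i ∈ J then a * θ else a * (1 - θ) else 1 - a := by
      rw [measureReal_def, Measure.pi_pi, ENNReal.toReal_prod]
      refine Finset.prod_congr rfl fun i _ => ?_
      rw [← measureReal_def]
      split_ifs
      exacts [h, hdiff, hcompl]
    have hinter : {x ∈ I | x ∈ J} = J := by
      rw [Finset.filter_mem_eq_inter, Finset.inter_eq_right.2 hJI]
    have hcard : ({x ∈ I | x ∉ J}).card = I.card - J.card := by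
      rw [← Finset.sdiff_eq_filter, Finset.card_sdiff_of_subset hJI]
    have hcard' : ({x | x ∉ I} : Finset ι).card = Fintype.card ι - I.card := by
      rw [← Finset.compl_filter, Finset.card_compl]
      simp
    rw [hpi, Finset.prod_ite, Finset.prod_ite, Finset.filter_univ_mem]
    simp only [Finset.prod_const]
    rw [hinter, hcard, hcard', mul_pow, mul_pow]
    have hpow : a ^ I.card = a ^ J.card * a ^ (I.card - J.card) := by
      rw [← pow_add, Nat.add_sub_of_le (Finset.card_le_card hJI)]
    rw [hpow]
    ring
  calc (Measure.pi fun _ : ι => ν).real {ω | binomCDF (Finset.card {i | ω i ∈ A ∧ ω i ∈ E})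
        (Finset.card {i | ω i ∈ A}) θ ≤ δ}
      ≤ (Measure.pi fun _ : ι => ν).real (⋃ I ∈ (Finset.univ : Finset (Finset ι)),
          ⋃ J ∈ I.powerset.filter (fun J => binomCDF J.card I.card θ ≤ δ), cell I J) := by
        refine measureReal_mono (fun ω hω => ?_) (measure_ne_top _ _)
        simp only [Set.mem_iUnion]
        refine ⟨Finset.univ.filter fun i => ω i ∈ A, Finset.mem_univ _,
          Finset.univ.filter fun i => ω i ∈ A ∧ ω i ∈ E, ?_, fun i _ => ?_⟩
        · refine Finset.mem_filter.2 ⟨Finset.mem_powerset.2 fun i hi => ?_, hω⟩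
          simp only [Finset.mem_filter_univ] at hi ⊢
          exact hi.1
        · simp only [Finset.mem_filter_univ]
          split_ifs with h1 h2
          exacts [h2, ⟨h1, fun h3 => h2 ⟨h1, h3⟩⟩, h1]
    _ ≤ ∑ I : Finset ι, ∑ J ∈ I.powerset with binomCDF J.card I.card θ ≤ δ,
          (Measure.pi fun _ : ι => ν).real (cell I J) :=
        (measureReal_biUnion_finset_le _ _).trans
          (Finset.sum_le_sum fun I _ => measureReal_biUnion_finset_le _ _)
    _ ≤ ∑ I : Finset ι, a ^ I.card * (1 - a) ^ (Fintype.card ι - I.card) * δ := by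
        refine Finset.sum_le_sum fun I _ => ?_
        rw [Finset.sum_congr rfl fun J hJ =>
          hcell I J (Finset.mem_powerset.1 (Finset.mem_filter.1 hJ).1), ← Finset.mul_sum]
        exact mul_le_mul_of_nonneg_left (sum_powerset_binomCDF_le I hθ hδ) (by positivity)
    _ = δ := by
        rw [← Finset.sum_mul, Fintype.sum_pow_mul_eq_add_pow]
        simp

variable {X Y : Type*}

/-! ### The greedy threshold -/

theorem notMem_predSet_iff (f : X × Y → ℝ≥0) (τ : ℝ≥0) (z : X × Y) :
    z.2 ∉ predSet f τ z.1 ↔ f z < τ := by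
  simp [predSet]

-- Separating accepted errors from accepted non-errors puts the bound in the form `k, k + s` used by
-- `binomCDF_add_le`.
open Classical in
theorem uRSCP_greedyWeights {m : ℕ} (f : X × Y → ℝ≥0) (τ : ℝ≥0) (S : Fin m → X × Y)
    (V lo hi : Fin m → ℝ) (b δ : ℝ) :
    uRSCP (predSet f τ) S V (greedyWeights (predSet f τ) S lo hi) b δ =
      cpUpper (Finset.card {i | V i ≤ hi i / b ∧ f (S i) < τ})
        (Finset.card {i | V i ≤ hi i / b ∧ f (S i) < τ} +
          Finset.card {i | V i ≤ lo i / b ∧ ¬ f (S i) < τ}) δ := by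
  have herr : errorCount (predSet f τ)
      (acceptedSample S V (greedyWeights (predSet f τ) S lo hi) b) =
        Finset.card {i | V i ≤ hi i / b ∧ f (S i) < τ} := by
    rw [errorCount, acceptedSample, Multiset.countP_map, ← Finset.filter_val, Finset.filter_filter]
    refine congrArg Finset.card (Finset.filter_congr fun i _ => ?_)
    simp only [notMem_predSet_iff, greedyWeights]
    exact and_congr_left fun h => by rw [if_pos h]
  have hcard : (acceptedSample S V (greedyWeights (predSet f τ) S lo hi) b).card =
      Finset.card {i | V i ≤ hi i / b ∧ f (S i) < τ} +
        Finset.card {i | V i ≤ lo i / b ∧ ¬ f (S i) < τ} := by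
    rw [acceptedSample, Multiset.card_map, Finset.card_val,
      ← Finset.card_filter_add_card_filter_not (fun i => f (S i) < τ), Finset.filter_filter,
      Finset.filter_filter]
    congr 1 <;> refine congrArg Finset.card (Finset.filter_congr fun i _ => ?_) <;>
      simp only [notMem_predSet_iff, greedyWeights] <;>
      refine and_congr_left fun h => ?_
    · rw [if_pos h]
    · rw [if_neg h]
  rw [uRSCP, uCP, herr, hcard]

theorem mem_feasible_congr {m : ℕ} {f : X × Y → ℝ≥0} {S : Fin m → X × Y} {V lo hi : Fin m → ℝ}
    {b δ ε : ℝ} {τ τ' : ℝ≥0} (h : ∀ i, f (S i) < τ ↔ f (S i) < τ') :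
    τ ∈ feasible f S V lo hi b δ ε ↔ τ' ∈ feasible f S V lo hi b δ ε := by
  simp only [feasible, Set.mem_ofPred_eq, uRSCP_greedyWeights, h]

/-- Some sample point has a score at least as large as a given feasible threshold. -/
theorem exists_le_of_mem_feasible {m : ℕ} {f : X × Y → ℝ≥0} {S : Fin m → X × Y}
    {V lo hi : Fin m → ℝ} {b δ ε : ℝ} (hδ : δ < 1) (hε : ε < 1) {τ : ℝ≥0}
    (hτ : τ ∈ feasible f S V lo hi b δ ε) : ∃ i, τ ≤ f (S i) := by
  by_contra! h
  -- If every score is below `τ`, all accepted points are errors and the bound equals `1 > ε`.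
  simp only [feasible, Set.mem_ofPred_eq, uRSCP_greedyWeights, h, not_true_eq_false, and_false,
    Finset.filter_false, Finset.card_empty, add_zero, cpUpper_self _ hδ] at hτ
  exact hτ.not_gt hε

theorem bddAbove_feasible {m : ℕ} (f : X × Y → ℝ≥0) (S : Fin m → X × Y) (V lo hi : Fin m → ℝ)
    (b : ℝ) {δ ε : ℝ} (hδ : δ < 1) (hε : ε < 1) : BddAbove (feasible f S V lo hi b δ ε) := by
  obtain ⟨M, hM⟩ := (Set.finite_range fun i => f (S i)).bddAbove
  refine ⟨M, fun τ hτ => ?_⟩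
  obtain ⟨i, hi⟩ := exists_le_of_mem_feasible hδ hε hτ
  exact hi.trans (hM ⟨i, rfl⟩)

/-- The strict comparisons `f (S i) < τ` are locally constant from the left, hence so is
feasibility, and the supremum is itself feasible. -/
theorem isGreatest_tauHat {m : ℕ} {f : X × Y → ℝ≥0} {S : Fin m → X × Y} {V lo hi : Fin m → ℝ}
    {b δ ε : ℝ} (hδ : δ < 1) (hε : ε < 1) (hne : (feasible f S V lo hi b δ ε).Nonempty) :
    IsGreatest (feasible f S V lo hi b δ ε) (tauHat f S V lo hi b δ ε) := by
  have hlub : IsLUB (feasible f S V lo hi b δ ε) (tauHat f S V lo hi b δ ε) :=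
    isLUB_csSup hne (bddAbove_feasible f S V lo hi b hδ hε)
  refine ⟨?_, hlub.1⟩
  set t := tauHat f S V lo hi b δ ε
  by_contra hmem
  have hev : ∀ᶠ τ in nhdsWithin t (Set.Iic t), ∀ i, f (S i) < τ ↔ f (S i) < t := by
    refine Filter.eventually_all.2 fun i => ?_
    rcases lt_or_ge (f (S i)) t with h | h
    · filter_upwards [nhdsWithin_le_nhds (Ioi_mem_nhds h)] with τ hτ
      exact iff_of_true hτ h
    · filter_upwards [self_mem_nhdsWithin] with τ hτ
      exact iff_of_false (not_lt.2 (le_trans hτ h)) (not_lt.2 h)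
  obtain ⟨τ, hτ, hτS⟩ := ((hlub.frequently_mem hne).and_eventually hev).exists
  exact hmem ((mem_feasible_congr hτS).1 hτ)

open Classical in
/-- Inside the box, feasibility at the greedy weights bounds the error counts of the sample that
is accepted under the true weights, for every error set contained in that of the threshold. -/
theorem binomCDF_le_of_mem_feasible {m : ℕ} {f : X × Y → ℝ≥0} {S : Fin m → X × Y}
    {V lo hi w : Fin m → ℝ} {b δ ε θ : ℝ} {τ : ℝ≥0} {E : Set (X × Y)} (hb : 0 ≤ b)
    (hw : w ∈ uncertaintyBox lo hi) (hτ : τ ∈ feasible f S V lo hi b δ ε)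
    (hE : E ⊆ {z | f z < τ}) (hε0 : 0 ≤ ε) (hε : ε < 1) (hεθ : ε ≤ θ) (hθ : θ ≤ 1) :
    binomCDF (Finset.card {i | V i ≤ w i / b ∧ S i ∈ E}) (Finset.card {i | V i ≤ w i / b}) θ
      ≤ δ := by
  rw [feasible, Set.mem_ofPred_eq, uRSCP_greedyWeights] at hτ
  refine le_trans ?_ (binomCDF_le_of_cpUpper_le hτ hε hεθ hθ)
  rw [← Finset.card_filter_add_card_filter_not (s := {i | V i ≤ w i / b}) (fun i => S i ∈ E),
    Finset.filter_filter, Finset.filter_filter]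
  refine binomCDF_add_le (Finset.card_le_card ?_) (Finset.card_le_card ?_) ⟨hε0.trans hεθ, hθ⟩
  · intro i hi'
    rw [Finset.mem_filter_univ] at hi' ⊢
    exact ⟨hi'.1.trans (div_le_div_of_nonneg_right (hw i).2 hb), hE hi'.2⟩
  · intro i hi'
    rw [Finset.mem_filter_univ] at hi' ⊢
    exact ⟨hi'.1.trans (div_le_div_of_nonneg_right (hw i).1 hb), fun h => hi'.2 (hE h)⟩

/-! ### The critical error set -/

theorem expectedError_predSet [MeasurableSpace X] [MeasurableSpace Y] (Q : Measure (X × Y))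
    (f : X × Y → ℝ≥0) (τ : ℝ≥0) : expectedError Q (predSet f τ) = Q.real {z | f z < τ} := by
  simp only [expectedError, notMem_predSet_iff]

/-- The sublevel sets of mass greater than `ε` have a common measurable subset of mass at
least `ε`. -/
theorem exists_measurableSet_subset_sublevel {Ω : Type*} [MeasurableSpace Ω] (Q : Measure Ω)
    [IsFiniteMeasure Q] {f : Ω → ℝ≥0} (hf : Measurable f) {ε : ℝ} {τ₀ : ℝ≥0}
    (hτ₀ : ε < Q.real {z | f z < τ₀}) :
    ∃ E, MeasurableSet E ∧ ε ≤ Q.real E ∧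
      ∀ τ, ε < Q.real {z | f z < τ} → E ⊆ {z | f z < τ} := by
  set A : Set ℝ≥0 := {τ | ε < Q.real {z | f z < τ}} with hA
  have hmeas : ∀ τ, MeasurableSet {z | f z < τ} := fun τ => measurableSet_lt hf measurable_const
  have hle : ∀ τ, ε < Q.real {z | f z < τ} → sInf A ≤ τ := fun τ hτ => csInf_le' (s := A) hτ
  -- If the infimum is attained, its strict sublevel set works. Otherwise the non-strict one does:
  -- it is a decreasing limit of sets of mass above `ε`, which leaves only `≥ ε`.
  by_cases hmem : sInf A ∈ A
  · exact ⟨_, hmeas _, hmem.le, fun τ hτ z (hz : f z < sInf A) => hz.trans_le (hle τ hτ)⟩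
  refine ⟨{z | f z ≤ sInf A}, measurableSet_le hf measurable_const, ?_,
    fun τ hτ z (hz : f z ≤ sInf A) => ?_⟩
  · have hinter : {z | f z ≤ sInf A} = ⋂ τ > sInf A, {z | f z < τ} := by
      ext z
      simp only [Set.mem_ofPred_eq, Set.mem_iInter]
      exact ⟨fun h τ hτ => lt_of_le_of_lt h hτ, fun h => le_of_forall_gt h⟩
    have hlim := tendsto_measure_biInter_gt (μ := Q) (s := fun τ => {z | f z < τ}) (a := sInf A)
      (fun τ _ => (hmeas τ).nullMeasurableSet) (fun _ _ _ h z hz => lt_of_lt_of_le hz h)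
      ⟨sInf A + 1, by simp, measure_ne_top _ _⟩
    rw [← hinter] at hlim
    have hlim' := (ENNReal.tendsto_toReal (measure_ne_top Q _)).comp hlim
    refine ge_of_tendsto hlim' ?_
    filter_upwards [self_mem_nhdsWithin] with τ hτ
    obtain ⟨σ, hσ, hστ⟩ := exists_lt_of_csInf_lt ⟨τ₀, hτ₀⟩ hτ
    exact (lt_of_lt_of_le hσ (measureReal_mono fun z hz => lt_trans hz hστ)).le
  · exact hz.trans_lt ((hle τ hτ).lt_of_ne fun h => hmem (h ▸ hτ))

/-! ### Rejection sampling -/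

instance : IsProbabilityMeasure uniform01 := ⟨by simp [uniform01]⟩

theorem uniform01_Iic {c : ℝ} (h1 : c ≤ 1) :
    uniform01 (Set.Iic c) = ENNReal.ofReal c := by
  rw [uniform01, Measure.restrict_apply measurableSet_Iic,
    show Set.Iic c ∩ Set.Icc 0 1 = Set.Icc 0 c by
      ext x
      simp only [Set.mem_inter_iff, Set.mem_Iic, Set.mem_Icc]
      exact ⟨fun h => ⟨h.2.1, h.1⟩, fun h => ⟨h.2, h.1, h.2.trans h1⟩⟩]
  simp

variable [MeasurableSpace X] [MeasurableSpace Y]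

theorem measurable_importanceWeight {p q : X → ℝ≥0} (hp : Measurable p) (hq : Measurable q) :
    Measurable (importanceWeight p q) := by
  unfold importanceWeight
  fun_prop

theorem withDensity_importanceWeight {μ : Measure X} {p q : X → ℝ≥0} (hp : Measurable p)
    (hq : Measurable q) (hpq : ∀ x, p x = 0 → q x = 0) :
    (μ.withDensity fun x => (p x : ℝ≥0∞)).withDensity
      (fun x => ENNReal.ofReal (importanceWeight p q x)) = μ.withDensity fun x => (q x : ℝ≥0∞) := by
  rw [← withDensity_mul _ (by fun_prop) (measurable_importanceWeight hp hq).ennreal_ofReal]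
  congr 1
  ext x
  simp only [Pi.mul_apply]
  rw [importanceWeight, ← NNReal.coe_div, ENNReal.ofReal_coe_nnreal, ← ENNReal.coe_mul]
  congr 1
  -- Where `p` vanishes, so does `q`, and both densities are zero.
  rcases eq_or_ne (p x) 0 with h | h
  · simp [h, hpq x h]
  · exact mul_div_cancel₀ _ h

/-- Under covariate shift, a density of the covariates is a density of the joint laws. -/
theorem setLIntegral_eq_of_isCondKernel {P Q : Measure (X × Y)} [IsProbabilityMeasure P]
    [IsProbabilityMeasure Q] (κ : Kernel X Y) [IsMarkovKernel κ] [P.IsCondKernel κ]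
    [Q.IsCondKernel κ] {w : X → ℝ≥0∞} (hw : Measurable w) (hQ : Q.fst = P.fst.withDensity w)
    {E : Set (X × Y)} (hE : MeasurableSet E) : ∫⁻ z in E, w z.1 ∂P = Q E := by
  have hκ : Measurable fun x => κ x (Prod.mk x ⁻¹' E) := Kernel.measurable_kernel_prodMk_left hE
  rw [← lintegral_indicator hE, ← Measure.IsCondKernel.disintegrate (ρ := P) (ρCond := κ),
    Measure.lintegral_compProd (Measurable.indicator (by fun_prop) hE)]
  conv_rhs => rw [← Measure.IsCondKernel.disintegrate (ρ := Q) (ρCond := κ)]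
  rw [Measure.compProd_apply hE, hQ, lintegral_withDensity_eq_lintegral_mul _ hw hκ]
  refine lintegral_congr fun x => ?_
  have : (fun y => E.indicator (fun z : X × Y => w z.1) (x, y)) =
      (Prod.mk x ⁻¹' E).indicator fun _ => w x := by
    ext y
    by_cases hy : (x, y) ∈ E
    · rw [Set.indicator_of_mem hy, Set.indicator_of_mem (by exact hy)]
    · rw [Set.indicator_of_notMem hy, Set.indicator_of_notMem (by exact hy)]
  rw [this, lintegral_indicator_const (measurable_prodMk_left hE)]
  rfl

/-- The acceptance region of rejection sampling with weights `w` bounded by `b`. -/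
def acceptRegion (w : X → ℝ) (b : ℝ) : Set ((X × Y) × ℝ) := {u | u.2 ≤ w u.1.1 / b}

theorem measurableSet_acceptRegion {w : X → ℝ} (hw : Measurable w) (b : ℝ) :
    MeasurableSet (acceptRegion w b : Set ((X × Y) × ℝ)) :=
  measurableSet_le measurable_snd (by fun_prop)

/-- An accepted example is distributed according to the target. -/
theorem measureReal_acceptRegion_inter {P Q : Measure (X × Y)} [IsProbabilityMeasure P]
    [IsProbabilityMeasure Q] (κ : Kernel X Y) [IsMarkovKernel κ] [P.IsCondKernel κ]
    [Q.IsCondKernel κ] {w : X → ℝ} (hw : Measurable w) {b : ℝ} (hb0 : 0 < b)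
    (hb : ∀ x, w x ≤ b) (hQ : Q.fst = P.fst.withDensity fun x => ENNReal.ofReal (w x))
    {E : Set (X × Y)} (hE : MeasurableSet E) :
    (P.prod uniform01).real (acceptRegion w b ∩ Prod.fst ⁻¹' E) = b⁻¹ * Q.real E := by
  have hS := (measurableSet_acceptRegion (Y := Y) hw b).inter (measurable_fst hE)
  -- Given an example, acceptance has probability `w / b`; here `w ≤ b` keeps the cutoff within `[0,
  -- 1]` from above.
  have hslice : ∀ z, uniform01 (Prod.mk z ⁻¹' (acceptRegion w b ∩ Prod.fst ⁻¹' E)) =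
      E.indicator (fun z => ENNReal.ofReal b⁻¹ * ENNReal.ofReal (w z.1)) z := by
    intro z
    by_cases hz : z ∈ E
    · rw [Set.indicator_of_mem hz, ← ENNReal.ofReal_mul (inv_nonneg.2 hb0.le), ← div_eq_inv_mul,
        ← uniform01_Iic ((div_le_one hb0).2 (hb _))]
      congr 1
      ext v
      simp [acceptRegion, hz]
    · rw [Set.indicator_of_notMem hz, show Prod.mk z ⁻¹' (acceptRegion w b ∩ Prod.fst ⁻¹' E) = ∅ by
        ext v
        simp [hz], measure_empty]
  rw [measureReal_def, Measure.prod_apply hS, lintegral_congr hslice, lintegral_indicator hE,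
    lintegral_const_mul _ (by fun_prop),
    setLIntegral_eq_of_isCondKernel κ hw.ennreal_ofReal hQ hE, ENNReal.toReal_mul,
    ENNReal.toReal_ofReal (inv_nonneg.2 hb0.le), measureReal_def]

open Classical in
/-- Validity of the rejection-sampling Clopper-Pearson test at the true importance weights. -/
theorem measureReal_binomCDF_accepted_le {P Q : Measure (X × Y)} [IsProbabilityMeasure P]
    [IsProbabilityMeasure Q] (κ : Kernel X Y) [IsMarkovKernel κ] [P.IsCondKernel κ]
    [Q.IsCondKernel κ] {w : X → ℝ} (hw : Measurable w) {b : ℝ} (hb0 : 0 < b)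
    (hb : ∀ x, w x ≤ b) (hQ : Q.fst = P.fst.withDensity fun x => ENNReal.ofReal (w x))
    {E : Set (X × Y)} (hE : MeasurableSet E) {δ : ℝ} (hδ : 0 ≤ δ) (m : ℕ) :
    ((Measure.pi fun _ : Fin m => P).prod (Measure.pi fun _ : Fin m => uniform01)).real
      {a | binomCDF (Finset.card {i | a.2 i ≤ w (a.1 i).1 / b ∧ a.1 i ∈ E})
        (Finset.card {i | a.2 i ≤ w (a.1 i).1 / b}) (Q.real E) ≤ δ} ≤ δ := by
  have hpres := measurePreserving_arrowProdEquivProdArrow (X × Y) ℝ (Fin m) (fun _ => P)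
    (fun _ => uniform01)
  rw [measureReal_def, ← hpres.measure_preimage_equiv, ← measureReal_def]
  -- The acceptance probability is `1 / b`, so an accepted point falls in `E` with probability
  -- `Q(E)`.
  have hall := measureReal_acceptRegion_inter κ hw hb0 hb hQ MeasurableSet.univ
  rw [Set.preimage_univ, Set.inter_univ, probReal_univ, mul_one] at hall
  exact measureReal_pi_binomCDF_le (P.prod uniform01) (measurableSet_acceptRegion hw b)
    (measurable_fst hE) ⟨measureReal_nonneg, measureReal_le_one⟩ hδ
    (by rw [hall, measureReal_acceptRegion_inter κ hw hb0 hb hQ hE])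

/-- With `b ≤ 0` the density would vanish, and `Q` with it. -/
theorem bound_pos_of_withDensity {P Q : Measure X} [IsProbabilityMeasure Q] {w : X → ℝ}
    (hQ : Q = P.withDensity fun x => ENNReal.ofReal (w x)) {b : ℝ} (hb : ∀ x, w x ≤ b) : 0 < b := by
  by_contra! h
  have hzero : (fun x => ENNReal.ofReal (w x)) = 0 := by
    ext x
    exact ENNReal.ofReal_of_nonpos ((hb x).trans h)
  rw [hzero, withDensity_zero] at hQ
  exact IsProbabilityMeasure.ne_zero Q hQ

theorem measurableSet_mem_uncertaintyBox {α : Type*} [MeasurableSpace α] {m : ℕ}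
    {w lo hi : α → Fin m → ℝ} (hw : Measurable w) (hlo : Measurable lo) (hhi : Measurable hi) :
    MeasurableSet {a | w a ∈ uncertaintyBox (lo a) (hi a)} := by
  have : {a | w a ∈ uncertaintyBox (lo a) (hi a)} =
      ⋂ i, {a | lo a i ≤ w a i} ∩ {a | w a i ≤ hi a i} := by
    ext a
    simp [uncertaintyBox]
  rw [this]
  exact MeasurableSet.iInter fun i =>
    (measurableSet_le (by fun_prop) (by fun_prop)).inter
      (measurableSet_le (by fun_prop) (by fun_prop))

instance (P Q : Measure (X × Y)) [IsProbabilityMeasure P] [IsProbabilityMeasure Q] (m n : ℕ) :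
    IsProbabilityMeasure (dataLaw P Q m n) := by
  unfold dataLaw
  infer_instance

theorem measurePreserving_labeled (P Q : Measure (X × Y)) [IsProbabilityMeasure P]
    [IsProbabilityMeasure Q] (m n : ℕ) :
    MeasurePreserving (fun ω : (Fin m → X × Y) × (Fin m → ℝ) × (Fin n → X) => (ω.1, ω.2.1))
      (dataLaw P Q m n)
      ((Measure.pi fun _ : Fin m => P).prod (Measure.pi fun _ : Fin m => uniform01)) :=
  (MeasurePreserving.id _).prod measurePreserving_fst

theorem measurePreserving_covariates (P Q : Measure (X × Y)) [IsProbabilityMeasure P]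
    [IsProbabilityMeasure Q] (m n : ℕ) :
    MeasurePreserving
      (fun ω : (Fin m → X × Y) × (Fin m → ℝ) × (Fin n → X) => (fun i => (ω.1 i).1, ω.2.2))
      (dataLaw P Q m n)
      ((Measure.pi fun _ : Fin m => P.fst).prod (Measure.pi fun _ : Fin n => Q.fst)) :=
  (measurePreserving_pi (fun _ : Fin m => P) (fun _ => P.fst)
    fun _ => ⟨measurable_fst, rfl⟩).prod measurePreserving_snd

end CovShift

open CovShift in
theorem theorem4 {X Y : Type*} [MeasurableSpace X] [MeasurableSpace Y]
    -- source and target distributions, with densities `p`, `q` of the covariates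
    (P Q : Measure (X × Y)) [IsProbabilityMeasure P] [IsProbabilityMeasure Q]
    (μ : Measure X) (p q : X → ℝ≥0) (hp : Measurable p) (hq : Measurable q)
    (hP : P.fst = μ.withDensity (fun x => (p x : ℝ≥0∞)))
    (hQ : Q.fst = μ.withDensity (fun x => (q x : ℝ≥0∞)))
    -- covariate shift: a common conditional distribution of the label given the covariate
    (κ : Kernel X Y) [IsMarkovKernel κ] [P.IsCondKernel κ] [Q.IsCondKernel κ]
    -- the importance weights `q / p` are finite and bounded by `b`
    (hpq : ∀ x, p x = 0 → q x = 0)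
    (b : ℝ) (hb : ∀ x, importanceWeight p q x ≤ b)
    (f : X × Y → ℝ≥0) (hf : Measurable f)
    (ε δC δw : ℝ) (hε : ε ∈ Set.Ioo 0 1) (hδC : δC ∈ Set.Ioo 0 1) (hδw : δw ∈ Set.Ioo 0 1)
    (m n : ℕ)
    -- the bounds of the box, as functions of the unlabeled source and target samples
    (lo hi : (Fin m → X) × (Fin n → X) → Fin m → ℝ) (hlo : Measurable lo) (hhi : Measurable hi)
    (hW : 1 - δw ≤
      ((Measure.pi fun _ : Fin m => P.fst).prod (Measure.pi fun _ : Fin n => Q.fst)).real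
        {a | (fun i => importanceWeight p q (a.1 i)) ∈ uncertaintyBox (lo a) (hi a)}) :
    -- the maximum that defines the threshold is attained whenever the problem is feasible
    (∀ (S : Fin m → X × Y) (V : Fin m → ℝ) (T : Fin n → X),
      let l := lo (fun i => (S i).1, T)
      let h := hi (fun i => (S i).1, T)
      (feasible f S V l h b δC ε).Nonempty →
        IsGreatest (feasible f S V l h b δC ε) (tauHat f S V l h b δC ε)) ∧
    1 - δC - δw ≤ (dataLaw P Q m n).real
      {ω | ∀ τ : ℝ≥0,
        τ ≤ tauHat f ω.1 ω.2.1 (lo (fun i => (ω.1 i).1, ω.2.2)) (hi (fun i => (ω.1 i).1, ω.2.2))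
          b δC ε →
        expectedError Q (predSet f τ) ≤ ε} := by
  classical
  refine ⟨fun S V T => isGreatest_tauHat hδC.2 hε.2, ?_⟩
  set G : Set ((Fin m → X × Y) × (Fin m → ℝ) × (Fin n → X)) := {ω | ∀ τ : ℝ≥0,
    τ ≤ tauHat f ω.1 ω.2.1 (lo (fun i => (ω.1 i).1, ω.2.2)) (hi (fun i => (ω.1 i).1, ω.2.2))
      b δC ε → expectedError Q (predSet f τ) ≤ ε} with hG
  by_cases hsafe : ∀ τ, Q.real {z | f z < τ} ≤ ε
  · have : G = Set.univ := Set.eq_univ_of_forall fun ω τ _ => by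
      rw [expectedError_predSet]
      exact hsafe τ
    rw [this, probReal_univ]
    linarith [hδC.1, hδw.1]
  push Not at hsafe
  obtain ⟨τ₀, hτ₀⟩ := hsafe
  obtain ⟨E, hE, hεE, hEsub⟩ := exists_measurableSet_subset_sublevel Q hf hτ₀
  set w := importanceWeight p q with hw
  have hwm : Measurable w := measurable_importanceWeight hp hq
  have hdens : Q.fst = P.fst.withDensity fun x => ENNReal.ofReal (w x) := by
    rw [hP, hQ, withDensity_importanceWeight hp hq hpq]
  have hb0 : 0 < b := bound_pos_of_withDensity hdens hb
  set B : Set ((Fin m → X) × (Fin n → X)) :=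
    {a | (fun i => w (a.1 i)) ∈ uncertaintyBox (lo a) (hi a)}
  have hB : MeasurableSet B := measurableSet_mem_uncertaintyBox (by fun_prop) hlo hhi
  set D : Set ((Fin m → X × Y) × (Fin m → ℝ)) :=
    {a | binomCDF (Finset.card {i | a.2 i ≤ w (a.1 i).1 / b ∧ a.1 i ∈ E})
        (Finset.card {i | a.2 i ≤ w (a.1 i).1 / b}) (Q.real E) ≤ δC}
  have hcov := measurePreserving_covariates P Q m n
  have hlab := measurePreserving_labeled P Q m n
  -- Covering the whole space and using subadditivity avoids measurability of the good event `G`.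
  have hcover : (Set.univ : Set ((Fin m → X × Y) × (Fin m → ℝ) × (Fin n → X))) ⊆
      G ∪ ((fun ω => (fun i => (ω.1 i).1, ω.2.2)) ⁻¹' Bᶜ ∪ (fun ω => (ω.1, ω.2.1)) ⁻¹' D) := by
    intro ω _
    by_contra hω
    simp only [Set.mem_union, not_or, Set.mem_preimage, Set.mem_compl_iff, not_not] at hω
    obtain ⟨hωG, hωB, hωD⟩ := hω
    simp only [hG, Set.mem_ofPred_eq, not_forall, not_le, expectedError_predSet] at hωG
    obtain ⟨τ, hτ, hτε⟩ := hωG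
    set t := tauHat f ω.1 ω.2.1 (lo (fun i => (ω.1 i).1, ω.2.2))
      (hi (fun i => (ω.1 i).1, ω.2.2)) b δC ε with ht
    have hne : (feasible f ω.1 ω.2.1 (lo (fun i => (ω.1 i).1, ω.2.2))
        (hi (fun i => (ω.1 i).1, ω.2.2)) b δC ε).Nonempty := by
      -- With no feasible threshold, `τ̂ = 0` forces `τ = 0`, whose error set `{f < 0}` is empty.
      by_contra hemp
      rw [Set.not_nonempty_iff_eq_empty] at hemp
      rw [tauHat, hemp, csSup_empty] at ht
      have : τ = 0 := le_antisymm (hτ.trans_eq ht) bot_le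
      simp only [this, not_lt_zero, Set.ofPred_false, measureReal_empty] at hτε
      linarith [hε.1]
    exact hωD (binomCDF_le_of_mem_feasible hb0.le hωB (isGreatest_tauHat hδC.2 hε.2 hne).1
      ((hEsub τ hτε).trans fun z hz => lt_of_lt_of_le hz hτ) hε.1.le hε.2 hεE measureReal_le_one)
  have hBc : (dataLaw P Q m n).real ((fun ω => (fun i => (ω.1 i).1, ω.2.2)) ⁻¹' Bᶜ) ≤ δw := by
    rw [measureReal_def, hcov.measure_preimage hB.compl.nullMeasurableSet, ← measureReal_def,
      probReal_compl_eq_one_sub hB]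
    linarith
  have hDle : (dataLaw P Q m n).real ((fun ω => (ω.1, ω.2.1)) ⁻¹' D) ≤ δC := by
    refine le_trans ?_ (measureReal_binomCDF_accepted_le κ hwm hb0 hb
      hdens hE hδC.1.le m)
    -- For a preimage, `≤` holds without measurability of `D`.
    refine ENNReal.toReal_mono (measure_ne_top _ _) ?_
    rw [← hlab.map_eq]
    exact Measure.le_map_apply hlab.measurable.aemeasurable D
  have htotal := measureReal_mono (μ := dataLaw P Q m n) hcover
  rw [probReal_univ] at htotal
  have h1 := measureReal_union_le (μ := dataLaw P Q m n) G
    ((fun ω => (fun i => (ω.1 i).1, ω.2.2)) ⁻¹' Bᶜ ∪ (fun ω => (ω.1, ω.2.1)) ⁻¹' D)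
  have h2 := measureReal_union_le (μ := dataLaw P Q m n)
    ((fun ω => (fun i => (ω.1 i).1, ω.2.2)) ⁻¹' Bᶜ) ((fun ω => (ω.1, ω.2.1)) ⁻¹' D)
  linarith
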